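/- **Definitions.** Boolean functions and CNFs are identified with their sets of satisfying assignments; $|F|$ is the number of satisfying assignments of $F$. For a finite graph $G$ without isolated vertices, $\varphi(G)$ is the CNF whose variables are the vertices of $G$ and whose clauses are $(u\vee v)$ for all edges $\{u,v\}$ of $G$. For a positive integer $k$, let $\mathcal G_k$ be the class of all graphs (up to isomorphism) of the form $T(H)$, where $T$ is a complete rooted ternary tree (of any height), $H$ is a path with $2\lfloor k/4\rfloor$ vertices, and $T(H)$ consists of disjoint copies $H^v$ of $H$, one for each vertex $v$ of $T$, together with an edge between the copies in $H^u$ and $H^v$ of each vertex of $H$ whenever $u$ and $v$ are adjacent in $T$. For a constant $c_1$ let $$\mathbf\Phi_k=\{\varphi(G)\;:\;G\in\mathcal G_k,\ |V(G)|\ge k^{2c_1}\}.$$ A nondeterministic read-once branching program (NROBP) on a set $V$ of variables is a finite directed acyclic graph $Z$ (parallel edges allowed) with exactly one source and exactly one sink, some of whose edges are labelled with literals of $V$, such that each variable of $V$ occurs exactly once on each source-sink path. It computes the Boolean function whose satisfying assignments are exactly the sets of literals labelling the source-sink paths. Its size is its number of nodes. **Theorem.** There are universal constants $c_0\in\mathbb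 N$, $c_1\ge 1$ and $c>0$ such that, with $\mathbf\Phi_k$ defined through this $c_1$, the following holds for every integer $k\ge c_0$. Let $\varphi\in\mathbf\Phi_k$, let $n$ be its number of variables, and let $F\subseteq\varphi$ be a Boolean function on the same variables with $|\varphi|\le 2|F|$. Then every NROBP computing $F$ has size at least $n^{k/c}$. -/

import Mathlib

universe u v w

namespace ReadOnce

open scoped SimpleGraph

/-! ### CNFs; Boolean functions as sets of satisfying assignments -/

/-- A literal over the variable set `X`: `(x, true)` is `x` and `(x, false)` is `¬ x`. -/
abbrev Literal (X : Type u) : Type u := X × Bool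

/-- A Boolean function on `X`, regarded as the set of its satisfying assignments. -/
abbrev BoolFun (X : Type u) : Type u := Set (X → Bool)

/-- A CNF over `X`: a set of clauses, each clause being a set of literals. -/
abbrev CNF (X : Type u) : Type u := Set (Set (Literal X))

/-- The set of satisfying assignments of a CNF. -/
def CNF.sat {X : Type u} (φ : CNF X) : BoolFun X :=
  {A | ∀ C ∈ φ, ∃ l ∈ C, A l.1 = l.2}

/-- The CNF `φ(G)`: variables are the vertices, clauses are `(x ∨ y)` for the edges `{x, y}`. -/
def graphCNF {V : Type u} (G : SimpleGraph V) : CNF V :=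
  {C | ∃ x y : V, G.Adj x y ∧ C = {(x, true), (y, true)}}

/-! ### The classes of graphs and of CNFs -/

/-- Vertices of the complete rooted ternary tree of height `h`: a vertex is the sequence of
choices of a child on the way from the root (the empty list) to it. -/
abbrev TernaryVertex (h : ℕ) : Type := {l : List (Fin 3) // l.length ≤ h}

/-- The complete rooted ternary tree of height `h`: the children of `l` are `l ++ [a]`,
`a : Fin 3`. -/
def ternaryTree (h : ℕ) : SimpleGraph (TernaryVertex h) where
  Adj l m := (∃ a, m.1 = l.1 ++ [a]) ∨ (∃ a, l.1 = m.1 ++ [a])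
  symm := ⟨fun _ _ hlm => hlm.symm⟩
  loopless := ⟨fun l hl => by simp at hl⟩

/-- Membership in the class `𝒢ₖ`: up to isomorphism, `G` is the graph `T(H)` with `T` a complete
rooted ternary tree and `H` a path with `2⌊k/4⌋` vertices. The graph `T(H)` (a copy of `H` for
every vertex of `T`, copies of the same vertex of `H` being joined along the edges of `T`) is the
box product of `T` and `H`. -/
def GraphClass (k : ℕ) {V : Type u} (G : SimpleGraph V) : Prop :=
  ∃ h : ℕ, Nonempty (G ≃g (ternaryTree h □ SimpleGraph.pathGraph (2 * (k / 4))))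

/-- The members on the variable set `V` of the class `Φₖ` of CNFs, with parameter `c₁`:
the CNFs `φ(G)` with `G ∈ 𝒢ₖ` and `|V(G)| ≥ k ^ (2 c₁)`. -/
def CNFClass (c₁ : ℝ) (k : ℕ) (V : Type u) : Set (CNF V) :=
  {φ | ∃ G : SimpleGraph V, GraphClass k G ∧ (k : ℝ) ^ (2 * c₁) ≤ (Nat.card V : ℝ) ∧
    φ = graphCNF G}

/-! ### Nondeterministic read-once branching programs -/

/-- The literals labelling a directed path, in the order of occurrence, for a partial labelling
of the edges by literals. -/
def pathLiterals {X : Type u} {N : Type v} [Quiver.{w} N]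
    (label : ∀ a b : N, (a ⟶ b) → Option (Literal X)) {a : N} :
    ∀ {b : N}, Quiver.Path a b → List (Literal X)
  | _, .nil => []
  | _, .cons (b := b) (c := c) p e => pathLiterals label p ++ (label b c e).toList

/-- A (uniform) nondeterministic read-once branching program on the variable set `X`: a finite
directed acyclic graph (parallel edges are allowed) with exactly one source and exactly one
sink, some edges being labelled with literals of `X`, such that every variable occurs exactly
once on every source-sink path. -/
structure NROBP (X : Type u) where
  /-- The nodes. -/
  Node : Type v
  [finiteNode : Finite Node]
  /-- The edges. -/
  [quiver : Quiver.{w} Node]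
  [finiteEdge : ∀ a b : Node, Finite (a ⟶ b)]
  acyclic : ∀ (a : Node) (p : Quiver.Path a a), p = Quiver.Path.nil
  source : Node
  sink : Node
  source_iff : ∀ a : Node, (∀ b : Node, IsEmpty (b ⟶ a)) ↔ a = source
  sink_iff : ∀ a : Node, (∀ b : Node, IsEmpty (a ⟶ b)) ↔ a = sink
  /-- The label of an edge, if there is one. -/
  label : ∀ a b : Node, (a ⟶ b) → Option (Literal X)
  read_once : ∀ p : Quiver.Path source sink,
    ((pathLiterals label p).map Prod.fst).Nodup ∧
      ∀ x : X, x ∈ (pathLiterals label p).map Prod.fst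

attribute [instance] NROBP.finiteNode NROBP.quiver NROBP.finiteEdge

namespace NROBP

variable {X : Type u}

/-- The set `A(P)` of literals labelling a path `P`. -/
def literals (Z : NROBP.{u, v, w} X) {a b : Z.Node} (p : Quiver.Path a b) : Set (Literal X) :=
  {l | l ∈ pathLiterals Z.label p}

/-- The Boolean function represented by `Z`: its satisfying assignments are those whose set of
literals is `A(P)` for some source-sink path `P`. -/
def toBoolFun (Z : NROBP.{u, v, w} X) : BoolFun X :=
  {A | ∃ p : Quiver.Path Z.source Z.sink, Z.literals p = {l | A l.1 = l.2}}

/-- The size: the number of nodes. -/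
noncomputable def size (Z : NROBP.{u, v, w} X) : ℕ := Nat.card Z.Node

end NROBP

end ReadOnce

namespace ReadOnce

open scoped SimpleGraph

/-! ### Vertex covers of crossing edges in box products -/

section Grid

variable {α β : Type*} {R : SimpleGraph α} {H : SimpleGraph β}

/-! Cut a source-sink path at a node `b`, and let `x`, `y` be adjacent in `G`, with `x` read before
`b` and `y` after it. If some path into `b` sets `x` false and some path out of `b` sets `y` false,
concatenating them gives an accepted assignment violating `x ∨ y`. So the variables that all
assignments through `b` set to true form a vertex cover of the edges crossing the cut.

It remains to choose the cut so that every such cover has at least `d` vertices, with `d` of order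
`k log n` (`exists_prefix_cover`). This goes by induction on the height of the tree: of the three
subtrees below the root, take the one whose good threshold is the median. Inside it induction
applies. Outside it, the other two subtrees put many vertices on both sides of the threshold, and
the remaining product graph costs `m` further cover vertices (`le_card_cover_boxProd`).

Finally, since the degrees are bounded, forcing `d` variables to be true leaves at most a fraction
`(64/65)^d` of the satisfying assignments (`ncard_sat_true_mul_le`). As the assignments through such
nodes exhaust `F`, at least half of `φ`, there are at least `(65/64)^d / 2` nodes
(`NROBP.pow_le_size`). -/

theorem exists_adj_mem_notMem {R : SimpleGraph α} (hR : R.Preconnected) {P : α → Prop} {a b : α}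
    (ha : P a) (hb : ¬ P b) : ∃ x y, R.Adj x y ∧ P x ∧ ¬ P y := by
  obtain ⟨p⟩ := hR a b
  obtain ⟨d, -, h1, h2⟩ := p.exists_boundary_dart {x | P x} ha hb
  exact ⟨d.fst, d.snd, d.adj, h1, h2⟩

/-- Every fibre `{a} × β` meets `S` in the column `i`, so a fibre that also meets `Sᶜ` contains a
crossing edge. The fibres are disjoint, and at least `m` of them are needed to hold `Sᶜ`. -/
theorem le_card_cover_of_column [Fintype α] [Fintype β] [DecidableEq α] [DecidableEq β]
    (hH : H.Preconnected) (S C : Finset (α × β)) (m : ℕ)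
    (hS : m * Fintype.card β ≤ Sᶜ.card) (i : β) (hi : ∀ a, (a, i) ∈ S)
    (hC : ∀ x y, (R □ H).Adj x y → x ∈ S → y ∉ S → x ∈ C ∨ y ∈ C) : m ≤ C.card := by
  have hsub : Sᶜ.image Prod.fst ⊆ C.image Prod.fst := by
    intro a ha
    obtain ⟨⟨a', j⟩, hj, rfl⟩ := Finset.mem_image.1 ha
    rw [Finset.mem_compl] at hj
    obtain ⟨x, y, hxy, hx, hy⟩ :=
      exists_adj_mem_notMem hH (P := fun b => (a', b) ∈ S) (hi a') hj
    have := hC (a', x) (a', y) (by simp [SimpleGraph.boxProd_adj, hxy]) hx hy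
    rcases this with h | h
    · exact Finset.mem_image.2 ⟨_, h, rfl⟩
    · exact Finset.mem_image.2 ⟨_, h, rfl⟩
  have h1 : Sᶜ ⊆ (Sᶜ.image Prod.fst) ×ˢ (Finset.univ : Finset β) := by
    intro x hx
    exact Finset.mem_product.2 ⟨Finset.mem_image_of_mem _ hx, Finset.mem_univ _⟩
  have h2 := Finset.card_le_card h1
  rw [Finset.card_product, Finset.card_univ] at h2
  have h3 : (Sᶜ.image Prod.fst).card ≤ C.card :=
    (Finset.card_le_card hsub).trans Finset.card_image_le
  have hpos : 0 < Fintype.card β := Fintype.card_pos_iff.2 ⟨i⟩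
  exact Nat.le_of_mul_le_mul_right ((hS.trans h2).trans (Nat.mul_le_mul_right _ h3)) hpos

/-- A vertex cover of the edges between two large parts of a box product is large. -/
theorem le_card_cover_boxProd [Fintype α] [Fintype β] [DecidableEq α] [DecidableEq β]
    (hR : R.Preconnected) (hH : H.Preconnected) (S C : Finset (α × β)) (m : ℕ)
    (hm : m ≤ Fintype.card β) (hS : m * Fintype.card β ≤ S.card)
    (hSc : m * Fintype.card β ≤ Sᶜ.card)
    (hC : ∀ x y, (R □ H).Adj x y → x ∈ S → y ∉ S → x ∈ C ∨ y ∈ C) : m ≤ C.card := by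
  by_cases h1 : ∃ i, ∀ a, (a, i) ∈ S
  · obtain ⟨i, hi⟩ := h1
    exact le_card_cover_of_column hH S C m hSc i hi hC
  by_cases h2 : ∃ i, ∀ a, (a, i) ∉ S
  · obtain ⟨i, hi⟩ := h2
    refine le_card_cover_of_column (R := R) hH Sᶜ C m (by rwa [compl_compl]) i
      (fun a => Finset.mem_compl.2 (hi a)) ?_
    intro x y hxy hx hy
    rw [Finset.mem_compl] at hx
    rw [Finset.mem_compl, not_not] at hy
    exact (hC y x hxy.symm hy hx).symm
  push Not at h1 h2
  -- No column `α × {i}` lies on one side, so each contains a crossing edge, and the columns are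
  -- disjoint.
  have : (Finset.univ : Finset β) ⊆ C.image Prod.snd := by
    intro i _
    obtain ⟨a, ha⟩ := h1 i
    obtain ⟨b, hb⟩ := h2 i
    obtain ⟨x, y, hxy, hx, hy⟩ :=
      exists_adj_mem_notMem hR (P := fun a => (a, i) ∈ S) hb ha
    rcases hC (x, i) (y, i) (by simp [SimpleGraph.boxProd_adj, hxy]) hx hy with h | h
    · exact Finset.mem_image.2 ⟨_, h, rfl⟩
    · exact Finset.mem_image.2 ⟨_, h, rfl⟩
  calc m ≤ (Finset.univ : Finset β).card := hm
    _ ≤ (C.image Prod.snd).card := Finset.card_le_card this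
    _ ≤ C.card := Finset.card_image_le

end Grid

/-! ### The ternary tree -/

instance (h : ℕ) : Finite (TernaryVertex h) := List.finite_length_le (Fin 3) h

noncomputable instance (h : ℕ) : Fintype (TernaryVertex h) := Fintype.ofFinite _

namespace TernaryVertex

/-- The root. -/
def root (h : ℕ) : TernaryVertex h := ⟨[], Nat.zero_le _⟩

/-- The embedding of a tree as the subtree below the child `a` of the root. -/
def cons {h : ℕ} (a : Fin 3) (l : TernaryVertex h) : TernaryVertex (h + 1) :=
  ⟨a :: l.1, by simpa using l.2⟩

theorem cons_injective {h : ℕ} (a : Fin 3) : Function.Injective (cons (h := h) a) := by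
  intro l m hlm
  simpa [cons, Subtype.ext_iff] using hlm

theorem ternaryTree_adj_cons {h : ℕ} (a : Fin 3) {l m : TernaryVertex h} :
    (ternaryTree (h + 1)).Adj (cons a l) (cons a m) ↔ (ternaryTree h).Adj l m := by
  simp [ternaryTree, cons]

/-- The root and the subtrees below the children of the root. -/
def equivOption (h : ℕ) : TernaryVertex (h + 1) ≃ Option (Fin 3 × TernaryVertex h) where
  toFun
    | ⟨[], _⟩ => none
    | ⟨a :: l, hl⟩ => some (a, ⟨l, by simpa using hl⟩)
  invFun
    | none => root _
    | some (a, l) => cons a l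
  left_inv := by rintro ⟨_ | ⟨a, l⟩, hl⟩ <;> rfl
  right_inv := by rintro (_ | ⟨a, l⟩) <;> rfl

theorem two_mul_card_add_one (h : ℕ) : 2 * Nat.card (TernaryVertex h) + 1 = 3 ^ (h + 1) := by
  induction h with
  | zero =>
    have : Unique (TernaryVertex 0) :=
      { default := root 0
        uniq := fun l => Subtype.ext (List.length_eq_zero_iff.1 (Nat.le_zero.1 l.2)) }
    simp
  | succ h ih =>
    rw [Nat.card_congr (equivOption h), Finite.card_option, Nat.card_prod, pow_succ, ← ih]
    simp
    ring

/-- The tree stays connected when the subtree below a child of the root is removed. -/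
theorem preconnected_induce_head?_ne {h : ℕ} (b : Fin 3) :
    ((ternaryTree h).induce {l : TernaryVertex h | l.1.head? ≠ some b}).Preconnected := by
  have key : ∀ (l : List (Fin 3)) (hl : l.length ≤ h) (hb : l.head? ≠ some b),
      ((ternaryTree h).induce {l : TernaryVertex h | l.1.head? ≠ some b}).Reachable
        ⟨⟨l, hl⟩, hb⟩ ⟨root h, by simp [root]⟩ := by
    intro l
    induction l using List.reverseRecOn with
    | nil => intro hl hb; exact SimpleGraph.Reachable.refl _
    | append_singleton l a ih =>
      intro hl hb
      have hl' : l.length ≤ h := by simp at hl; omega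
      have hb' : l.head? ≠ some b := by
        rcases l with _ | ⟨c, l⟩
        · simp
        · simpa using hb
      refine SimpleGraph.Reachable.trans (SimpleGraph.Adj.reachable ?_) (ih hl' hb')
      exact Or.inr ⟨a, rfl⟩
  rintro ⟨⟨l, hl⟩, hb⟩ ⟨⟨l', hl'⟩, hb'⟩
  exact (key l hl hb).trans (key l' hl' hb').symm

end TernaryVertex

/-! ### Balanced prefixes of orderings -/

/-- Since `r` is injective, raising the threshold by one adds at most one element. The least
threshold reaching `K` elements therefore has at most `K` below it. -/
theorem exists_prefix_card {α : Type*} [Fintype α] (r : α → ℕ) (hr : Function.Injective r)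
    (K : ℕ) (hK : 2 * K ≤ Fintype.card α) :
    ∃ t, K ≤ (Finset.univ.filter fun x => r x < t).card ∧
      K ≤ (Finset.univ.filter fun x => ¬ r x < t).card := by
  classical
  have hex : ∃ t, K ≤ (Finset.univ.filter fun x => r x < t).card := by
    refine ⟨Finset.univ.sup r + 1, ?_⟩
    rw [Finset.filter_true_of_mem fun x hx => Nat.lt_succ_of_le (Finset.le_sup hx),
      Finset.card_univ]
    omega
  refine ⟨Nat.find hex, Nat.find_spec hex, ?_⟩
  have hadd := Finset.card_filter_add_card_filter_not (s := Finset.univ)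
    (fun x => r x < Nat.find hex)
  rw [Finset.card_univ] at hadd
  suffices (Finset.univ.filter fun x => r x < Nat.find hex).card ≤ K by omega
  rcases hn : Nat.find hex with _ | t
  · simp
  have ht : (Finset.univ.filter fun x => r x < t).card < K := by
    simpa using Nat.find_min hex (m := t) (by omega)
  have hone : (Finset.univ.filter fun x => r x = t).card ≤ 1 :=
    Finset.card_le_one.2 fun x hx y hy => hr (by simp at hx hy; rw [hx, hy])
  have hsub : (Finset.univ.filter fun x => r x < t + 1) ⊆
      (Finset.univ.filter fun x => r x < t) ∪ (Finset.univ.filter fun x => r x = t) := by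
    intro x hx
    simp at hx ⊢
    omega
  have := (Finset.card_le_card hsub).trans (Finset.card_union_le _ _)
  omega

/-- Every ordering of the product of a ternary tree and a path has a prefix such that the edges
leaving it cannot be covered by few vertices. -/
theorem exists_prefix_cover (m h₀ : ℕ) (hm : 2 * m ≤ Nat.card (TernaryVertex h₀)) (j : ℕ)
    (r : TernaryVertex (h₀ + j) × Fin (2 * m) → ℕ) (hr : Function.Injective r) :
    ∃ t, m * (2 * m) ≤ (Finset.univ.filter fun x => r x < t).card ∧
      m * (2 * m) ≤ (Finset.univ.filter fun x => ¬ r x < t).card ∧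
      ∀ C : Finset (TernaryVertex (h₀ + j) × Fin (2 * m)),
        (∀ x y, (ternaryTree (h₀ + j) □ SimpleGraph.pathGraph (2 * m)).Adj x y →
          r x < t → ¬ r y < t → x ∈ C ∨ y ∈ C) → m * j ≤ C.card := by
  classical
  induction j with
  | zero =>
    obtain ⟨t, h1, h2⟩ := exists_prefix_card r hr (m * (2 * m)) (by
      rw [Fintype.card_prod, Fintype.card_fin, ← mul_assoc]
      refine Nat.mul_le_mul_right _ ?_
      rwa [Nat.card_eq_fintype_card] at hm)
    exact ⟨t, h1, h2, by simp⟩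
  | succ j ih =>
    let ι (a : Fin 3) (x : TernaryVertex (h₀ + j) × Fin (2 * m)) :
      TernaryVertex (h₀ + j + 1) × Fin (2 * m) := (TernaryVertex.cons a x.1, x.2)
    have hι (a : Fin 3) : Function.Injective (ι a) :=
      (TernaryVertex.cons_injective a).prodMap Function.injective_id
    choose t ht₁ ht₂ ht using fun a => ih (fun x => r (ι a x)) (hr.comp (hι a))
    -- `b` is the child with the median threshold. At `t b`, the subtree of `a` still has many
    -- vertices below the threshold and that of `c` many vertices not below it.
    obtain ⟨a, b, c, hab, hcb, htab, htbc⟩ :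
        ∃ a b c : Fin 3, a ≠ b ∧ c ≠ b ∧ t a ≤ t b ∧ t b ≤ t c := by
      have hmono := Tuple.monotone_sort t
      refine ⟨Tuple.sort t 0, Tuple.sort t 1, Tuple.sort t 2, ?_, ?_,
        hmono (by decide : (0 : Fin 3) ≤ 1), hmono (by decide : (1 : Fin 3) ≤ 2)⟩ <;>
      simp
    let s : Set (TernaryVertex (h₀ + j + 1)) := {l | l.1.head? ≠ some b}
    let κ (x : s × Fin (2 * m)) : TernaryVertex (h₀ + j + 1) × Fin (2 * m) := (x.1.1, x.2)
    have hκ : Function.Injective κ := Subtype.val_injective.prodMap Function.injective_id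
    let S : Finset (s × Fin (2 * m)) := Finset.univ.filter fun x => r (κ x) < t b
    have hSc : Sᶜ = Finset.univ.filter fun x => ¬ r (κ x) < t b := by
      ext x; simp [S]
    have hmem (a : Fin 3) (hab : a ≠ b) (l : TernaryVertex (h₀ + j)) :
        TernaryVertex.cons a l ∈ s := by
      simpa [s, TernaryVertex.cons] using hab
    have hS₁ : m * (2 * m) ≤ S.card := by
      refine (ht₁ a).trans (Finset.card_le_card_of_injOn
        (fun x => (⟨TernaryVertex.cons a x.1, hmem a hab x.1⟩, x.2)) ?_ ?_)
      · intro x hx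
        simp only [Finset.coe_filter, Finset.mem_univ, true_and, Set.mem_ofPred_eq] at hx
        simpa [S, κ] using hx.trans_le htab
      · intro x _ y _ hxy
        exact hι a (congrArg κ hxy)
    have hS₂ : m * (2 * m) ≤ Sᶜ.card := by
      rw [hSc]
      refine (ht₂ c).trans (Finset.card_le_card_of_injOn
        (fun x => (⟨TernaryVertex.cons c x.1, hmem c hcb x.1⟩, x.2)) ?_ ?_)
      · intro x hx
        simp only [Finset.coe_filter, Finset.mem_univ, true_and, Set.mem_ofPred_eq,
          not_lt] at hx
        simpa [κ] using htbc.trans hx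
      · intro x _ y _ hxy
        exact hι c (congrArg κ hxy)
    refine ⟨t b, hS₁.trans ?_, hS₂.trans ?_, fun C hC => ?_⟩
    · refine Finset.card_le_card_of_injOn κ ?_ hκ.injOn
      intro x hx
      simpa [S] using hx
    · rw [hSc]
      refine Finset.card_le_card_of_injOn κ ?_ hκ.injOn
      intro x hx
      simpa using hx
    -- `C` splits into its part inside the subtree of `b`, bounded by induction, and its part
    -- outside, bounded by the box product lemma.
    · let C₁ : Finset (TernaryVertex (h₀ + j) × Fin (2 * m)) :=
        Finset.univ.filter fun x => ι b x ∈ C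
      let C₂ : Finset (s × Fin (2 * m)) := Finset.univ.filter fun x => κ x ∈ C
      have hC₁ : m * j ≤ C₁.card := by
        refine ht b C₁ fun x y hxy hx hy => ?_
        have := hC (ι b x) (ι b y) (by
          change (ternaryTree (h₀ + j + 1) □ _).Adj _ _
          simpa [ι, SimpleGraph.boxProd_adj, TernaryVertex.ternaryTree_adj_cons,
            (TernaryVertex.cons_injective b).eq_iff] using hxy) hx hy
        simpa [C₁] using this
      have hC₂ : m ≤ C₂.card := by
        refine le_card_cover_boxProd (H := SimpleGraph.pathGraph (2 * m))
          (TernaryVertex.preconnected_induce_head?_ne (h := h₀ + j + 1) b)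
          (SimpleGraph.pathGraph_preconnected _) S C₂ m (by simp; omega) (by simpa using hS₁)
          (by simpa using hS₂) fun x y hxy hx hy => ?_
        have := hC (κ x) (κ y) (by
          change (ternaryTree (h₀ + j + 1) □ _).Adj _ _
          simpa [κ, SimpleGraph.boxProd_adj, Subtype.ext_iff] using hxy)
          (by simpa [S] using hx) (by simpa [S] using hy)
        simpa [C₂] using this
      have hdisj : Disjoint (C₁.image (ι b)) (C₂.image κ) := by
        rw [Finset.disjoint_left]
        intro x hx hx'
        obtain ⟨y, -, rfl⟩ := Finset.mem_image.1 hx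
        obtain ⟨z, -, hz⟩ := Finset.mem_image.1 hx'
        have h1 := z.1.2
        have h2 : z.1.1 = TernaryVertex.cons b y.1 := congrArg Prod.fst hz
        rw [h2] at h1
        exact h1 rfl
      have hsub : C₁.image (ι b) ∪ C₂.image κ ⊆ C := by
        intro x hx
        rcases Finset.mem_union.1 hx with hx | hx <;>
        · obtain ⟨y, hy, rfl⟩ := Finset.mem_image.1 hx
          exact (Finset.mem_filter.1 hy).2
      have := Finset.card_le_card hsub
      rw [Finset.card_union_of_disjoint hdisj, Finset.card_image_of_injective _ (hι b),
        Finset.card_image_of_injective _ hκ] at this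
      rw [mul_add, mul_one]
      omega

/-! ### Satisfying assignments with prescribed true variables -/

section Counting

variable {V : Type u}

theorem mem_sat_graphCNF {G : SimpleGraph V} {A : V → Bool} :
    A ∈ (graphCNF G).sat ↔ ∀ x y, G.Adj x y → A x = true ∨ A y = true := by
  constructor
  · intro hA x y hxy
    obtain ⟨l, hl, hAl⟩ := hA _ ⟨x, y, hxy, rfl⟩
    rcases hl with rfl | rfl
    · exact Or.inl hAl
    · exact Or.inr hAl
  · rintro hA C ⟨x, y, hxy, rfl⟩
    rcases hA x y hxy with h | h
    · exact ⟨_, Or.inl rfl, h⟩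
    · exact ⟨_, Or.inr rfl, h⟩

/-- Each new variable required to be true costs a factor `2^D / (2^D + 1)`: assignments with `w`
true map at most `2^D` to one to assignments with `w` false. -/
theorem ncard_sat_true_mul_le [Finite V] (G : SimpleGraph V) (D : ℕ)
    (hD : ∀ x, (G.neighborSet x).ncard ≤ D) (C : Finset V) :
    {A ∈ (graphCNF G).sat | ∀ x ∈ C, A x = true}.ncard * (2 ^ D + 1) ^ C.card ≤
      (2 ^ D) ^ C.card * (graphCNF G).sat.ncard := by
  classical
  induction C using Finset.induction_on with
  | empty => simp
  | insert w C hw ih =>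
    set X := {A ∈ (graphCNF G).sat | ∀ x ∈ C, A x = true} with hX
    set Y := {A ∈ (graphCNF G).sat | ∀ x ∈ insert w C, A x = true} with hY
    set Y' := {A ∈ X | A w = false} with hY'
    have hYX : Y.ncard + Y'.ncard ≤ X.ncard := by
      rw [← Set.ncard_union_eq]
      · refine Set.ncard_le_ncard ?_
        rintro A (hA | hA)
        · exact ⟨hA.1, fun x hx => hA.2 x (Finset.mem_insert_of_mem hx)⟩
        · exact hA.1
      · rw [Set.disjoint_left]
        intro A hA hA'
        have := hA.2 w (Finset.mem_insert_self _ _)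
        rw [hA'.2] at this
        exact Bool.noConfusion this
    have hflip : Y.ncard ≤ Y'.ncard * 2 ^ D := by
      -- Making `w` false is repaired by making all its neighbours true. Only the old values on the
      -- neighbours, at most `2^D` patterns, are lost.
      let f (A : V → Bool) : V → Bool := fun x =>
        if x = w then false else if G.Adj w x then true else A x
      have hf (A) (hA : A ∈ Y) : f A ∈ Y' := by
        refine ⟨⟨mem_sat_graphCNF.2 fun x y hxy => ?_, fun x hx => ?_⟩, by simp [f]⟩
        · have := mem_sat_graphCNF.1 hA.1 x y hxy
          by_cases hx : x = w
          · subst hx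
            right
            simp [f, hxy, hxy.ne']
          by_cases hy : y = w
          · subst hy
            left
            simp [f, hxy.symm, hxy.ne]
          by_cases hx' : G.Adj w x
          · left; simp [f, hx, hx']
          by_cases hy' : G.Adj w y
          · right; simp [f, hy, hy']
          simpa [f, hx, hy, hx', hy'] using this
        · have hxw : x ≠ w := fun h => hw (h ▸ hx)
          have := hA.2 x (Finset.mem_insert_of_mem hx)
          simp [f, hxw, this]
      let g (A : Y) : Y' × (G.neighborSet w → Bool) := (⟨f A.1, hf A.1 A.2⟩, fun x => A.1 x)
      have hg : Function.Injective g := by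
        intro A B hAB
        ext x : 2
        have h1 : f A.1 = f B.1 := congrArg (fun p => p.1.1) hAB
        have h2 : (fun x : G.neighborSet w => A.1 x.1) = fun x => B.1 x.1 :=
          congrArg Prod.snd hAB
        by_cases hx : x = w
        · rw [hx, A.2.2 w (Finset.mem_insert_self _ _), B.2.2 w (Finset.mem_insert_self _ _)]
        by_cases hx' : G.Adj w x
        · exact congrFun h2 ⟨x, hx'⟩
        · simpa [f, hx, hx'] using congrFun h1 x
      have := Nat.card_le_card_of_injective g hg
      rw [Nat.card_prod, Nat.card_fun, Nat.card_coe_set_eq, Nat.card_coe_set_eq,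
        Nat.card_coe_set_eq, Nat.card_eq_fintype_card, Fintype.card_bool] at this
      exact this.trans (Nat.mul_le_mul_left _ (Nat.pow_le_pow_right (by norm_num) (hD w)))
    rw [Finset.card_insert_of_notMem hw]
    calc Y.ncard * (2 ^ D + 1) ^ (C.card + 1)
        = (Y.ncard * 2 ^ D + Y.ncard) * (2 ^ D + 1) ^ C.card := by ring
      _ ≤ (Y.ncard * 2 ^ D + Y'.ncard * 2 ^ D) * (2 ^ D + 1) ^ C.card := by gcongr
      _ = 2 ^ D * ((Y.ncard + Y'.ncard) * (2 ^ D + 1) ^ C.card) := by ring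
      _ ≤ 2 ^ D * (X.ncard * (2 ^ D + 1) ^ C.card) := by gcongr
      _ ≤ 2 ^ D * ((2 ^ D) ^ C.card * (graphCNF G).sat.ncard) := by gcongr
      _ = (2 ^ D) ^ (C.card + 1) * (graphCNF G).sat.ncard := by ring

end Counting

/-! ### Rectangles of read-once branching programs -/

theorem pathLiterals_comp {X : Type u} {N : Type v} [Quiver.{w} N]
    (label : ∀ a b : N, (a ⟶ b) → Option (Literal X)) {a b c : N}
    (p : Quiver.Path a b) (q : Quiver.Path b c) :
    pathLiterals label (p.comp q) = pathLiterals label p ++ pathLiterals label q := by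
  induction q with
  | nil => simp [pathLiterals]
  | cons q e ih => simp [pathLiterals, ih]

/-- An edge carries at most one literal, so every prefix of the literal sequence is realised by
cutting at a node. -/
theorem exists_comp_pathLiterals_eq_take {X : Type u} {N : Type v} [Quiver.{w} N]
    (label : ∀ a b : N, (a ⟶ b) → Option (Literal X)) (t : ℕ) {a b : N}
    (p : Quiver.Path a b) :
    ∃ (c : N) (p₁ : Quiver.Path a c) (p₂ : Quiver.Path c b), p = p₁.comp p₂ ∧
      pathLiterals label p₁ = (pathLiterals label p).take t := by
  induction p with
  | nil => exact ⟨a, .nil, .nil, rfl, by simp [pathLiterals]⟩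
  | @cons b b' p e ih =>
    obtain ⟨c, p₁, p₂, rfl, h⟩ := ih
    by_cases ht : t ≤ (pathLiterals label (p₁.comp p₂)).length
    · exact ⟨c, p₁, p₂.cons e, rfl, by
        rw [h, pathLiterals, List.take_append_of_le_length ht]⟩
    · refine ⟨b', (p₁.comp p₂).cons e, .nil, rfl, ?_⟩
      rw [List.take_of_length_le]
      rw [pathLiterals, List.length_append]
      have : (label b b' e).toList.length ≤ 1 := by cases label b b' e <;> simp
      omega

namespace NROBP

variable {X : Type u} (Z : NROBP.{u, v, w} X)

/-- The assignments carried by the source-sink paths through the node `b`. -/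
def through (b : Z.Node) : BoolFun X :=
  {A | ∃ (p : Quiver.Path Z.source b) (q : Quiver.Path b Z.sink),
    Z.literals (p.comp q) = {l | A l.1 = l.2}}

theorem literals_comp {a b c : Z.Node} (p : Quiver.Path a b) (q : Quiver.Path b c) :
    Z.literals (p.comp q) = Z.literals p ∪ Z.literals q := by
  ext l
  simp [literals, pathLiterals_comp]

theorem eq_of_mem_literals {p : Quiver.Path Z.source Z.sink} {x : X} {s s' : Bool}
    (h : (x, s) ∈ Z.literals p) (h' : (x, s') ∈ Z.literals p) : s = s' := by
  have := List.inj_on_of_nodup_map (Z.read_once p).1 h h' rfl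
  exact congrArg Prod.snd this

theorem exists_mem_literals (p : Quiver.Path Z.source Z.sink) (x : X) :
    ∃ s, (x, s) ∈ Z.literals p := by
  obtain ⟨⟨y, s⟩, hl, rfl⟩ := List.mem_map.1 ((Z.read_once p).2 x)
  exact ⟨s, hl⟩

theorem not_mem_literals_of_mem {b : Z.Node} {p : Quiver.Path Z.source b}
    {q : Quiver.Path b Z.sink} {x : X} {s s' : Bool} (h : (x, s) ∈ Z.literals p)
    (h' : (x, s') ∈ Z.literals q) : False := by
  have := (Z.read_once (p.comp q)).1
  rw [pathLiterals_comp, List.map_append] at this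
  exact List.disjoint_of_nodup_append this (List.mem_map.2 ⟨_, h, rfl⟩)
    (List.mem_map.2 ⟨_, h', rfl⟩)

theorem exists_mem_toBoolFun (p : Quiver.Path Z.source Z.sink) :
    ∃ A ∈ Z.toBoolFun, ∀ x s, (x, s) ∈ Z.literals p → A x = s := by
  choose A hA using Z.exists_mem_literals p
  have h : ∀ x s, (x, s) ∈ Z.literals p → A x = s := fun x s hs =>
    Z.eq_of_mem_literals (hA x) hs
  refine ⟨A, ⟨p, ?_⟩, h⟩
  ext ⟨x, s⟩
  refine ⟨fun hs => h x s hs, fun hs => ?_⟩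
  have hs : A x = s := hs
  exact hs ▸ hA x

theorem through_subset (b : Z.Node) : Z.through b ⊆ Z.toBoolFun :=
  fun _ ⟨p, q, h⟩ => ⟨p.comp q, h⟩

/-- The variables forced to be true by a node cover all the edges that cross the node. -/
theorem exists_cover_of_comp [Finite X] {G : SimpleGraph X}
    (hZ : Z.toBoolFun ⊆ (graphCNF G).sat) {b : Z.Node} (p : Quiver.Path Z.source b)
    (q : Quiver.Path b Z.sink) :
    ∃ C : Finset X, (∀ A ∈ Z.through b, ∀ x ∈ C, A x = true) ∧
      ∀ x y, G.Adj x y → (∃ s, (x, s) ∈ Z.literals p) → (¬ ∃ s, (y, s) ∈ Z.literals p) →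
        x ∈ C ∨ y ∈ C := by
  classical
  let C : Set X := {x | (∀ p' : Quiver.Path Z.source b, (x, true) ∈ Z.literals p') ∨
    ∀ q' : Quiver.Path b Z.sink, (x, true) ∈ Z.literals q'}
  refine ⟨C.toFinite.toFinset, ?_, ?_⟩
  · rintro A ⟨p', q', hA⟩ x hx
    have : ((x, true) : Literal X) ∈ Z.literals (p'.comp q') := by
      rw [literals_comp]
      rcases C.toFinite.mem_toFinset.1 hx with h | h
      · exact Or.inl (h p')
      · exact Or.inr (h q')
    rw [hA] at this
    exact this
  · intro x y hxy ⟨s, hx⟩ hy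
    rw [C.toFinite.mem_toFinset, C.toFinite.mem_toFinset]
    by_contra! hcon
    have h1 : ∃ p' : Quiver.Path Z.source b, (x, true) ∉ Z.literals p' := by
      by_contra! h
      exact hcon.1 (Or.inl h)
    have h2 : ∃ q' : Quiver.Path b Z.sink, (y, true) ∉ Z.literals q' := by
      by_contra! h
      exact hcon.2 (Or.inr h)
    obtain ⟨p', hp'⟩ := h1
    obtain ⟨q', hq'⟩ := h2
    have hyq : ∃ s, (y, s) ∈ Z.literals q := by
      obtain ⟨s', h⟩ := Z.exists_mem_literals (p.comp q) y
      rw [literals_comp] at h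
      exact h.elim (fun h => (hy ⟨s', h⟩).elim) fun h => ⟨s', h⟩
    obtain ⟨s₂, hyq⟩ := hyq
    -- `x` occurs on `p`, hence not on `q`. As `p'` followed by `q` must read `x`, it is read on
    -- `p'`.
    have hxp' : (x, false) ∈ Z.literals p' := by
      obtain ⟨s', h⟩ := Z.exists_mem_literals (p'.comp q) x
      rw [literals_comp] at h
      rcases h with h | h
      · cases s'
        · exact h
        · exact (hp' h).elim
      · exact (Z.not_mem_literals_of_mem hx h).elim
    have hyq' : (y, false) ∈ Z.literals q' := by
      obtain ⟨s', h⟩ := Z.exists_mem_literals (p'.comp q') y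
      obtain ⟨s'', h''⟩ := Z.exists_mem_literals (p.comp q') y
      rw [literals_comp] at h h''
      rcases h'' with h'' | h''
      · exact (hy ⟨_, h''⟩).elim
      · cases s''
        · exact h''
        · exact (hq' h'').elim
    obtain ⟨A, hA, hAl⟩ := Z.exists_mem_toBoolFun (p'.comp q')
    have hAx := hAl x false (by rw [literals_comp]; exact Or.inl hxp')
    have hAy := hAl y false (by rw [literals_comp]; exact Or.inr hyq')
    have := mem_sat_graphCNF.1 (hZ hA) x y hxy
    rw [hAx, hAy] at this
    simp at this

/-- If every ordering of the variables has a prefix such that covering the edges leaving it takes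
`d` vertices, then the assignments computed by the program split into rectangles, one for each
node, in each of which `d` variables are always true. -/
theorem exists_through [Finite X] {G : SimpleGraph X} (d : ℕ)
    (hG : ∀ r : X → ℕ, Function.Injective r → ∃ t, ∀ C : Finset X,
      (∀ x y, G.Adj x y → r x < t → ¬ r y < t → x ∈ C ∨ y ∈ C) → d ≤ C.card)
    (hZ : Z.toBoolFun ⊆ (graphCNF G).sat) {A : X → Bool} (hA : A ∈ Z.toBoolFun) :
    ∃ b, A ∈ Z.through b ∧
      ∃ C : Finset X, d ≤ C.card ∧ ∀ B ∈ Z.through b, ∀ x ∈ C, B x = true := by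
  classical
  obtain ⟨p, hp⟩ := hA
  obtain ⟨hnd, hall⟩ := Z.read_once p
  -- The ordering is the one in which this path reads the variables.
  obtain ⟨t, ht⟩ := hG (fun x => ((pathLiterals Z.label p).map Prod.fst).idxOf x)
    fun x y hxy => (List.idxOf_inj (hall x)).1 hxy
  obtain ⟨b, p₁, p₂, rfl, htake⟩ := exists_comp_pathLiterals_eq_take Z.label t p
  obtain ⟨C, hC, hcov⟩ := Z.exists_cover_of_comp hZ p₁ p₂
  refine ⟨b, ⟨p₁, p₂, hp⟩, C, ht C fun x y hxy hx hy => hcov x y hxy ?_ ?_, hC⟩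
  all_goals
    have hiff : ∀ z : X, (∃ s, (z, s) ∈ Z.literals p₁) ↔
        ((pathLiterals Z.label (p₁.comp p₂)).map Prod.fst).idxOf z < t := by
      intro z
      rw [← List.mem_take_iff_idxOf_lt (hall z), ← List.map_take, ← htake]
      simp [literals]
    first
    | exact (hiff x).2 hx
    | exact fun h => hy ((hiff y).1 h)

/-- The counting bound on the size. -/
theorem pow_le_size [Finite X] {G : SimpleGraph X} (d D : ℕ)
    (hD : ∀ x, (G.neighborSet x).ncard ≤ D)
    (hG : ∀ r : X → ℕ, Function.Injective r → ∃ t, ∀ C : Finset X,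
      (∀ x y, G.Adj x y → r x < t → ¬ r y < t → x ∈ C ∨ y ∈ C) → d ≤ C.card)
    (hZ : Z.toBoolFun ⊆ (graphCNF G).sat)
    (hF : (graphCNF G).sat.ncard ≤ 2 * Z.toBoolFun.ncard) :
    (2 ^ D + 1) ^ d ≤ 2 * Z.size * (2 ^ D) ^ d := by
  classical
  have : Fintype Z.Node := Fintype.ofFinite _
  let good : Finset Z.Node := Finset.univ.filter fun b =>
    ∃ C : Finset X, d ≤ C.card ∧ ∀ B ∈ Z.through b, ∀ x ∈ C, B x = true
  have hpos : 0 < (graphCNF G).sat.ncard := by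
    rw [Set.ncard_pos]
    exact ⟨fun _ => true, mem_sat_graphCNF.2 fun _ _ _ => Or.inl rfl⟩
  have hgood : ∀ b ∈ good, (Z.through b).ncard * (2 ^ D + 1) ^ d ≤
      (2 ^ D) ^ d * (graphCNF G).sat.ncard := by
    intro b hb
    obtain ⟨C, hdC, hC⟩ := (Finset.mem_filter.1 hb).2
    obtain ⟨C', hC', rfl⟩ := Finset.exists_subset_card_eq hdC
    refine le_trans (Nat.mul_le_mul_right _ (Set.ncard_le_ncard ?_))
      (ncard_sat_true_mul_le G D hD C')
    exact fun A hA => ⟨hZ (Z.through_subset b hA), fun x hx => hC A hA x (hC' hx)⟩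
  have hcover : Z.toBoolFun.ncard ≤ ∑ b ∈ good, (Z.through b).ncard := by
    refine (Set.ncard_le_ncard (t := ⋃ b ∈ good, Z.through b) ?_).trans
      (Finset.set_ncard_biUnion_le _ _)
    intro A hA
    obtain ⟨b, hb, hC⟩ := Z.exists_through d hG hZ hA
    simp only [Set.mem_iUnion]
    exact ⟨b, by simpa [good] using hC, hb⟩
  have hsum : Z.toBoolFun.ncard * (2 ^ D + 1) ^ d ≤
      Z.size * ((2 ^ D) ^ d * (graphCNF G).sat.ncard) :=
    calc Z.toBoolFun.ncard * (2 ^ D + 1) ^ d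
        ≤ ∑ b ∈ good, (Z.through b).ncard * (2 ^ D + 1) ^ d := by
          rw [← Finset.sum_mul]; gcongr
      _ ≤ good.card * ((2 ^ D) ^ d * (graphCNF G).sat.ncard) := by
          simpa using Finset.sum_le_card_nsmul good _ _ hgood
      _ ≤ Z.size * ((2 ^ D) ^ d * (graphCNF G).sat.ncard) := by
          gcongr
          rw [size, Nat.card_eq_fintype_card]
          exact Finset.card_le_univ _
  refine Nat.le_of_mul_le_mul_left ?_ hpos
  calc (graphCNF G).sat.ncard * (2 ^ D + 1) ^ d
      ≤ 2 * Z.toBoolFun.ncard * (2 ^ D + 1) ^ d := by gcongr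
    _ = 2 * (Z.toBoolFun.ncard * (2 ^ D + 1) ^ d) := by ring
    _ ≤ 2 * (Z.size * ((2 ^ D) ^ d * (graphCNF G).sat.ncard)) := by gcongr
    _ = (graphCNF G).sat.ncard * (2 * Z.size * (2 ^ D) ^ d) := by ring

end NROBP

/-! ### The graphs of the class -/

theorem ncard_neighborSet_ternaryTree_le {h : ℕ} (l : TernaryVertex h) :
    ((ternaryTree h).neighborSet l).ncard ≤ 4 := by
  classical
  rw [← Set.ncard_image_of_injective _ Subtype.val_injective]
  let s : Finset (List (Fin 3)) := {l.1.dropLast, l.1 ++ [0], l.1 ++ [1], l.1 ++ [2]}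
  refine (Set.ncard_le_ncard (t := (s : Set (List (Fin 3)))) ?_).trans ?_
  · rintro _ ⟨m, ⟨a, ha⟩ | ⟨a, ha⟩, rfl⟩
    · rw [ha]
      fin_cases a <;> simp [s]
    · simp [s, ha]
  · rw [Set.ncard_coe_finset]
    exact Finset.card_le_four

theorem ncard_neighborSet_pathGraph_le {n : ℕ} (i : Fin n) :
    ((SimpleGraph.pathGraph n).neighborSet i).ncard ≤ 2 := by
  classical
  rw [← Set.ncard_image_of_injective _ Fin.val_injective]
  let s : Finset ℕ := {i.1 + 1, i.1 - 1}
  refine (Set.ncard_le_ncard (t := (s : Set ℕ)) ?_).trans ?_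
  · rintro _ ⟨j, hj, rfl⟩
    rw [SimpleGraph.mem_neighborSet, SimpleGraph.pathGraph_adj] at hj
    simp [s]
    omega
  · rw [Set.ncard_coe_finset]
    exact Finset.card_le_two

theorem ncard_neighborSet_boxProd_le {h n : ℕ} (x : TernaryVertex h × Fin n) :
    ((ternaryTree h □ SimpleGraph.pathGraph n).neighborSet x).ncard ≤ 6 := by
  rw [SimpleGraph.neighborSet_boxProd]
  refine (Set.ncard_union_le _ _).trans ?_
  rw [Set.ncard_prod, Set.ncard_prod, Set.ncard_singleton, Set.ncard_singleton]
  have h1 := ncard_neighborSet_ternaryTree_le x.1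
  have h2 := ncard_neighborSet_pathGraph_le x.2
  omega

theorem ncard_neighborSet_eq_of_iso {V : Type*} {W : Type*} {G : SimpleGraph V}
    {G' : SimpleGraph W} (e : G ≃g G') (x : V) :
    (G.neighborSet x).ncard = (G'.neighborSet (e x)).ncard := by
  rw [← Nat.card_coe_set_eq, ← Nat.card_coe_set_eq]
  exact Nat.card_congr (e.mapNeighborSet x)

theorem exists_prefix_cover_of_iso {V : Type*} {G : SimpleGraph V} {m h₀ j : ℕ}
    (hm : 2 * m ≤ Nat.card (TernaryVertex h₀))
    (e : G ≃g (ternaryTree (h₀ + j) □ SimpleGraph.pathGraph (2 * m)))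
    (r : V → ℕ) (hr : Function.Injective r) :
    ∃ t, ∀ C : Finset V,
      (∀ x y, G.Adj x y → r x < t → ¬ r y < t → x ∈ C ∨ y ∈ C) → m * j ≤ C.card := by
  obtain ⟨t, -, -, ht⟩ := exists_prefix_cover m h₀ hm j (r ∘ e.symm)
    (hr.comp e.symm.injective)
  refine ⟨t, fun C hC => ?_⟩
  rw [← Finset.card_map e.toEquiv.toEmbedding]
  refine ht _ fun x y hxy hx hy => ?_
  have := hC (e.symm x) (e.symm y) (e.symm.map_adj_iff.2 hxy) hx hy
  rwa [Finset.mem_map_equiv, Finset.mem_map_equiv]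

/-! ### Numerical estimates -/

/-- Used to ensure that a tree of half the height already has enough vertices to start the
induction. -/
theorem le_three_pow_half {k h n : ℕ} (hk : 9 ≤ k) (hkn : k ^ 4 ≤ n)
    (hn : n ≤ k * 3 ^ (h + 1)) : k ≤ 3 ^ (h / 2) := by
  have h1 : k ^ 3 ≤ 3 ^ (h + 1) := by
    refine Nat.le_of_mul_le_mul_left (?_ : k * k ^ 3 ≤ k * 3 ^ (h + 1)) (by omega)
    calc k * k ^ 3 = k ^ 4 := by ring
      _ ≤ k * 3 ^ (h + 1) := hkn.trans hn
  have h2 : 3 ^ (h + 1) ≤ (3 * 3 ^ (h / 2)) ^ 2 := by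
    rw [← pow_succ', ← pow_mul]
    exact Nat.pow_le_pow_right (by norm_num) (by omega)
  have h3 : (3 * k) ^ 2 ≤ (3 * 3 ^ (h / 2)) ^ 2 :=
    calc (3 * k) ^ 2 = 9 * k ^ 2 := by ring
      _ ≤ k * k ^ 2 := by gcongr
      _ = k ^ 3 := by ring
      _ ≤ _ := h1.trans h2
  have := (Nat.pow_le_pow_iff_left (by norm_num)).1 h3
  omega

/-- With `u = 3^(hk/4096)`, one has `n^(k/16384) ≤ u` and `u² ≤ (65/64)^d ≤ 2s`. Since `u ≥ 2`, the
spare factor `u` absorbs the 2. -/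
theorem rpow_le_of_pow_le {k h n d s : ℕ} (hk : 4096 ≤ k) (hh : 1 ≤ h)
    (hn : n ≤ 3 ^ (4 * h)) (hd : h * k ≤ 16 * d)
    (hs : 65 ^ d ≤ 2 * s * 64 ^ d) : (n : ℝ) ^ ((k : ℝ) / 16384) ≤ s := by
  set u : ℝ := (3 : ℝ) ^ ((h : ℝ) * k / 4096) with hu
  have hh' : (1 : ℝ) ≤ h := by exact_mod_cast hh
  have hk' : (4096 : ℝ) ≤ k := by exact_mod_cast hk
  have hnu : (n : ℝ) ^ ((k : ℝ) / 16384) ≤ u := by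
    have : (n : ℝ) ≤ (3 : ℝ) ^ ((4 * h : ℕ) : ℝ) := by
      rw [Real.rpow_natCast]
      exact_mod_cast hn
    refine (Real.rpow_le_rpow (by positivity) this (by positivity)).trans_eq ?_
    rw [← Real.rpow_mul (by norm_num), hu]
    congr 1
    push_cast
    ring
  have hu2 : 2 ≤ u := by
    have : (1 : ℝ) ≤ (h : ℝ) * k / 4096 := by
      rw [le_div_iff₀ (by norm_num)]
      nlinarith
    calc (2 : ℝ) ≤ (3 : ℝ) ^ (1 : ℝ) := by norm_num
      _ ≤ u := Real.rpow_le_rpow_of_exponent_le (by norm_num) this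
  -- Bernoulli: `1 + 128/64 = 3`.
  have hbase : (3 : ℝ) ≤ (65 / 64 : ℝ) ^ (128 : ℝ) := by
    have h1 := one_add_mul_le_pow (a := (1 / 64 : ℝ)) (by norm_num) 128
    rw [show (128 : ℝ) = ((128 : ℕ) : ℝ) by norm_num, Real.rpow_natCast]
    norm_num at h1 ⊢
  have hdu : u * u ≤ (65 / 64 : ℝ) ^ d := by
    calc u * u = (3 : ℝ) ^ ((h : ℝ) * k / 2048) := by
          rw [hu, ← Real.rpow_add (by norm_num)]
          congr 1
          ring
      _ ≤ ((65 / 64 : ℝ) ^ (128 : ℝ)) ^ ((h : ℝ) * k / 2048) :=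
          Real.rpow_le_rpow (by norm_num) hbase (by positivity)
      _ = (65 / 64 : ℝ) ^ ((h : ℝ) * k / 16) := by
          rw [← Real.rpow_mul (by norm_num)]
          congr 1
          ring
      _ ≤ (65 / 64 : ℝ) ^ (d : ℝ) := by
          refine Real.rpow_le_rpow_of_exponent_le (by norm_num) ?_
          rw [div_le_iff₀ (by norm_num), mul_comm (d : ℝ)]
          exact_mod_cast hd
      _ = (65 / 64 : ℝ) ^ d := Real.rpow_natCast _ _
  have hsd : (65 / 64 : ℝ) ^ d ≤ 2 * s := by
    rw [div_pow, div_le_iff₀ (by positivity)]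
    exact_mod_cast hs
  nlinarith

end ReadOnce

/-! ### The main theorem: choice of parameters -/

theorem theorem4p3 :
    ∃ (c₀ : ℕ) (c₁ c : ℝ), 1 ≤ c₁ ∧ 0 < c ∧
      ∀ k : ℕ, c₀ ≤ k →
      ∀ (V : Type u) [Finite V] (φ : ReadOnce.CNF V), φ ∈ ReadOnce.CNFClass c₁ k V →
      ∀ F : ReadOnce.BoolFun V, F ⊆ φ.sat → φ.sat.ncard ≤ 2 * F.ncard →
      ∀ Z : ReadOnce.NROBP.{u, v, w} V, Z.toBoolFun = F →
        (Nat.card V : ℝ) ^ ((k : ℝ) / c) ≤ (Z.size : ℝ) := by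
  refine ⟨4096, 2, 16384, by norm_num, by norm_num, ?_⟩
  rintro k hk V _ _ ⟨G, ⟨h, ⟨e⟩⟩, hcard, rfl⟩ _ hF hF₂ Z rfl
  have hkn : k ^ 4 ≤ Nat.card V := by
    rw [show (2 * 2 : ℝ) = ((4 : ℕ) : ℝ) by norm_num, Real.rpow_natCast] at hcard
    exact_mod_cast hcard
  have hV : Nat.card V = Nat.card (ReadOnce.TernaryVertex h) * (2 * (k / 4)) := by
    rw [Nat.card_congr e.toEquiv, Nat.card_prod, Nat.card_fin]
  have htree (h : ℕ) := ReadOnce.TernaryVertex.two_mul_card_add_one h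
  have hn : Nat.card V ≤ k * 3 ^ (h + 1) := by
    rw [hV, mul_comm k]
    exact Nat.mul_le_mul (by have := htree h; omega) (by omega)
  have hk₀ : k ≤ 3 ^ (h / 2) := ReadOnce.le_three_pow_half (by omega) hkn hn
  have hh : 1 ≤ h := by
    by_contra hh
    obtain rfl : h = 0 := by omega
    simp at hk₀
    omega
  -- Half the height goes to the base case, and the other `j ≥ h/2` levels each contribute `k / 4`
  -- cover vertices.
  obtain ⟨j, hj⟩ : ∃ j, h = h / 2 + j := ⟨h - h / 2, by omega⟩
  have hbase : 2 * (k / 4) ≤ Nat.card (ReadOnce.TernaryVertex (h / 2)) := by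
    have := htree (h / 2)
    rw [pow_succ] at this
    omega
  -- The degree bound 6 is 4 from the tree plus 2 from the path, whence `2^6 = 64` and 65.
  have hsize := Z.pow_le_size (k / 4 * j) 6
    (fun x => (ReadOnce.ncard_neighborSet_eq_of_iso e x).trans_le
      (ReadOnce.ncard_neighborSet_boxProd_le _))
    (fun r hr => by
      generalize h / 2 = h₀ at hj hbase
      subst hj
      exact ReadOnce.exists_prefix_cover_of_iso hbase e r hr) hF hF₂
  refine ReadOnce.rpow_le_of_pow_le (d := k / 4 * j) (by omega) hh (hn.trans ?_) ?_
    (by norm_num at hsize ⊢; exact hsize)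
  · calc k * 3 ^ (h + 1) ≤ 3 ^ (h / 2) * 3 ^ (h + 1) := by gcongr
      _ = 3 ^ (h / 2 + (h + 1)) := (pow_add _ _ _).symm
      _ ≤ 3 ^ (4 * h) := Nat.pow_le_pow_right (by norm_num) (by omega)
  · calc h * k ≤ (2 * j) * (8 * (k / 4)) := Nat.mul_le_mul (by omega) (by omega)
      _ = 16 * (k / 4 * j) := by ring
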